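/- Let $p\in\mathbb{R}\setminus\{-1,0,1\}$. Let $E=[E_{abc}]_{a,b,c=1}^3$ be the array with $E_{123}=E_{231}=E_{312}=1$, $E_{132}=E_{213}=E_{321}=p$ and $E_{abc}=0$ whenever $(a,b,c)$ is not a permutation of $(1,2,3)$. Let $A_{p,0,0}(3)=(\mathsf A,u)$ be the compact quantum group that the Woronowicz construction relates to $E$: $\mathsf A$ is the universal unital C$^*$-algebra generated by the entries of a matrix $u=[u_{jk}]_{j,k=1}^3$ subject to the relations $$\sum_{s=1}^3 u_{js}u_{ks}^*=\delta_{jk}1=\sum_{s=1}^3 u_{sj}^*u_{sk},\qquad \sum_{i,j,k=1}^3 E_{ijk}\,u_{ai}u_{bj}u_{ck}=E_{abc}\,1\quad(a,b,c\in\{1,2,3\}),$$ with comultiplication $\Delta(u_{jk})=\sum_s u_{js}\otimes u_{sk}$. Let $A_3=\{e,x,y\}$ be the alternating group, where $x=(231)$ and $y=(312)$ in one-line notation, acting on the torus $\mathbb{T}^2$ by $$\phi_e(z,w)=(z,w),\qquad \phi_x(z,w)=(w,\overline{zw}),\qquad \phi_y(z,w)=(\overline{zw},z),$$ and let $G=\mathbb{T}^2\rtimes_\phi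 A_3$ be the compact group with the multiplication $(t_1;a)(t_2;b)=(t_1\,\phi_a(t_2);ab)$. For $g=(z,w;a)\in G$ let $\rho(g)$ be the $3\times 3$ matrix whose only nonzero entries are $\rho(g)_{1,a(1)}=z$, $\rho(g)_{2,a(2)}=w$, $\rho(g)_{3,a(3)}=\overline{zw}$. Then the C$^*$-algebra $\mathsf A$ is commutative (i.e. the quantum group $A_{p,0,0}(3)$ is trivial), and $A_{p,0,0}(3)\cong C(\mathbb{T}^2\rtimes_\phi A_3)$ as compact quantum groups. More precisely, there is a $*$-isomorphism $\Phi:\mathsf A\to C(G)$ with $\Phi(u_{ij})(g)=\rho(g)_{ij}$ for all $i,j$ and all $g\in G$, and, under the identification $C(G)\otimes C(G)=C(G\times G)$, one has $\big((\Phi\otimes\Phi)\Delta(a)\big)(g,h)=\Phi(a)(gh)$ for all $a\in\mathsf A$ and $g,h\in G$. -/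

import Mathlib

open scoped ENNReal SemidirectProduct

universe u

noncomputable section

/-! ## The universal C*-algebra of a three-dimensional array -/

/-- The relations imposed on a `3 × 3` matrix `v` over a unital `*`-algebra by an array `E`:
unitarity of `v`, and the twisted determinant condition. -/
structure IsWoronowiczMatrix (E : Fin 3 → Fin 3 → Fin 3 → ℂ) {B : Type*} [Ring B] [StarRing B]
    [Algebra ℂ B] (v : Matrix (Fin 3) (Fin 3) B) : Prop where
  mul_star : ∀ j k, ∑ s, v j s * star (v k s) = if j = k then 1 else 0
  star_mul : ∀ j k, ∑ s, star (v s j) * v s k = if j = k then 1 else 0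
  twisted_det : ∀ a b c, ∑ i, ∑ j, ∑ k, E i j k • (v a i * v b j * v c k) = E a b c • (1 : B)

/-- The entries of a unitary matrix over a C*-algebra are contractions. -/
theorem IsWoronowiczMatrix.norm_le_one {E : Fin 3 → Fin 3 → Fin 3 → ℂ} {B : Type*}
    [CStarAlgebra B] {v : Matrix (Fin 3) (Fin 3) B} (hv : IsWoronowiczMatrix E v) (i j : Fin 3) :
    ‖v i j‖ ≤ 1 := by
  let _ : PartialOrder B := CStarAlgebra.spectralOrder B
  have _ : StarOrderedRing B := CStarAlgebra.spectralOrderedRing B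
  have h := hv.star_mul j j
  rw [if_pos rfl] at h
  have h1 : star (v i j) * v i j ≤ 1 := by
    rw [← h]
    exact Finset.single_le_sum (f := fun s => star (v s j) * v s j)
      (fun s _ => star_mul_self_nonneg (v s j)) (Finset.mem_univ i)
  have h2 : ‖star (v i j) * v i j‖ ≤ 1 :=
    (CStarAlgebra.norm_le_one_iff_of_nonneg _ (star_mul_self_nonneg _)).2 h1
  rw [CStarRing.norm_star_mul_self] at h2
  nlinarith [norm_nonneg (v i j)]

/-- A realization of the relations: a nonzero unital C*-algebra with a matrix satisfying them. -/
structure WoronowiczRealization (E : Fin 3 → Fin 3 → Fin 3 → ℂ) : Type (u + 1) where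
  carrier : Type u
  [cstar : CStarAlgebra carrier]
  [nontrivial : Nontrivial carrier]
  mat : Matrix (Fin 3) (Fin 3) carrier
  isMat : IsWoronowiczMatrix E mat

attribute [instance] WoronowiczRealization.cstar WoronowiczRealization.nontrivial

/-- The C*-algebra of bounded families over all realizations. -/
abbrev WoronowiczProd (E : Fin 3 → Fin 3 → Fin 3 → ℂ) : Type (u + 1) :=
  lp (fun R : WoronowiczRealization.{u} E => R.carrier) ∞

instance (E : Fin 3 → Fin 3 → Fin 3 → ℂ) : CStarAlgebra (WoronowiczProd.{u} E) := {}

/-- The `(i, j)` entry of the universal matrix: the family of all `(i, j)` entries. -/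
def WoronowiczProd.gen (E : Fin 3 → Fin 3 → Fin 3 → ℂ) (i j : Fin 3) : WoronowiczProd.{u} E :=
  ⟨fun R => R.mat i j, memℓp_infty ⟨1, by
    rintro _ ⟨R, rfl⟩
    exact R.isMat.norm_le_one i j⟩⟩

/-- The closed unital `*`-subalgebra generated by the entries of the universal matrix. -/
def woronowiczSubalgebra (E : Fin 3 → Fin 3 → Fin 3 → ℂ) :
    StarSubalgebra ℂ (WoronowiczProd.{u} E) :=
  (StarAlgebra.adjoin ℂ
    (Set.range fun ij : Fin 3 × Fin 3 => WoronowiczProd.gen.{u} E ij.1 ij.2)).topologicalClosure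

/-- The universal unital C*-algebra generated by the entries of a `3 × 3` matrix subject to the
relations `IsWoronowiczMatrix E`, i.e. the C*-algebra of the compact quantum group related to `E`.
Its universal property is `woronowicz_universal`. -/
abbrev WoronowiczAlgebra (E : Fin 3 → Fin 3 → Fin 3 → ℂ) : Type (u + 1) :=
  woronowiczSubalgebra.{u} E

instance (E : Fin 3 → Fin 3 → Fin 3 → ℂ) : CStarAlgebra (WoronowiczAlgebra.{u} E) :=
  StarSubalgebra.cstarAlgebra (woronowiczSubalgebra.{u} E)
    (h_closed := StarSubalgebra.isClosed_topologicalClosure _)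

/-- The fundamental corepresentation: the universal matrix of generators. -/
def fundamentalMatrix (E : Fin 3 → Fin 3 → Fin 3 → ℂ) :
    Matrix (Fin 3) (Fin 3) (WoronowiczAlgebra.{u} E) :=
  fun i j => ⟨WoronowiczProd.gen E i j, StarSubalgebra.le_topologicalClosure _
    (StarAlgebra.subset_adjoin ℂ _ ⟨(i, j), rfl⟩)⟩

/-- Evaluation at a realization. -/
def woronowiczEval {E : Fin 3 → Fin 3 → Fin 3 → ℂ} (R : WoronowiczRealization.{u} E) :
    WoronowiczAlgebra.{u} E →⋆ₐ[ℂ] R.carrier where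
  toFun a := (a : WoronowiczProd.{u} E) R
  map_one' := rfl
  map_mul' _ _ := rfl
  map_zero' := rfl
  map_add' _ _ := rfl
  commutes' _ := rfl
  map_star' _ := rfl

theorem woronowiczEval_ext {E : Fin 3 → Fin 3 → Fin 3 → ℂ} {a b : WoronowiczAlgebra.{u} E}
    (h : ∀ R : WoronowiczRealization.{u} E, woronowiczEval R a = woronowiczEval R b) : a = b :=
  Subtype.ext (lp.ext (funext h))

theorem woronowiczEval_fundamentalMatrix {E : Fin 3 → Fin 3 → Fin 3 → ℂ}
    (R : WoronowiczRealization.{u} E) (i j : Fin 3) :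
    woronowiczEval R (fundamentalMatrix E i j) = R.mat i j := rfl

theorem fundamentalMatrix_isWoronowiczMatrix (E : Fin 3 → Fin 3 → Fin 3 → ℂ) :
    IsWoronowiczMatrix E (fundamentalMatrix.{u} E) where
  mul_star j k := woronowiczEval_ext fun R => by
    simp only [map_sum, map_mul, map_star, woronowiczEval_fundamentalMatrix, R.isMat.mul_star]
    split_ifs <;> simp
  star_mul j k := woronowiczEval_ext fun R => by
    simp only [map_sum, map_mul, map_star, woronowiczEval_fundamentalMatrix, R.isMat.star_mul]
    split_ifs <;> simp
  twisted_det a b c := woronowiczEval_ext fun R => by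
    simp only [map_sum, map_mul, map_smul, map_one, woronowiczEval_fundamentalMatrix,
      R.isMat.twisted_det]

/-- Unital `*`-homomorphisms are determined by their values on the fundamental matrix. -/
theorem woronowicz_hom_ext {E : Fin 3 → Fin 3 → Fin 3 → ℂ} {B : Type*} [CStarAlgebra B]
    {f g : WoronowiczAlgebra.{u} E →⋆ₐ[ℂ] B}
    (h : ∀ i j, f (fundamentalMatrix E i j) = g (fundamentalMatrix E i j)) : f = g := by
  have hf : Continuous f := AddMonoidHomClass.continuous_of_bound f 1 fun x => by
    simpa only [one_mul] using NonUnitalStarAlgHom.norm_apply_le f x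
  have hg : Continuous g := AddMonoidHomClass.continuous_of_bound g 1 fun x => by
    simpa only [one_mul] using NonUnitalStarAlgHom.norm_apply_le g x
  refine StarAlgHom.ext_topologicalClosure hf hg (StarAlgHom.ext_adjoin ?_)
  rintro ⟨_, hx⟩ ⟨⟨i, j⟩, rfl⟩
  exact h i j

/-- The universal property: every matrix over a unital C*-algebra that satisfies the relations is
the image of the fundamental matrix under a unique unital `*`-homomorphism. -/
theorem woronowicz_universal {E : Fin 3 → Fin 3 → Fin 3 → ℂ} {B : Type u} [CStarAlgebra B]
    {v : Matrix (Fin 3) (Fin 3) B} (hv : IsWoronowiczMatrix E v) :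
    ∃! f : WoronowiczAlgebra.{u} E →⋆ₐ[ℂ] B, ∀ i j, f (fundamentalMatrix E i j) = v i j := by
  obtain hB | hB := subsingleton_or_nontrivial B
  · exact ⟨⟨⟨⟨⟨⟨fun _ => 0, Subsingleton.elim _ _⟩, fun _ _ => Subsingleton.elim _ _⟩,
      Subsingleton.elim _ _, fun _ _ => Subsingleton.elim _ _⟩, fun _ => Subsingleton.elim _ _⟩,
      fun _ => Subsingleton.elim _ _⟩, fun _ _ => Subsingleton.elim _ _,
      fun _ _ => StarAlgHom.ext fun _ => Subsingleton.elim _ _⟩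
  · exact ⟨woronowiczEval ⟨B, v, hv⟩, fun _ _ => rfl,
      fun g hg => woronowicz_hom_ext fun i j => hg i j⟩

/-! ## The arrays of the quantum groups `A_{p,k,m}(3)` -/

/-- The array with `E₁₂₃ = 1`, `E₁₃₂ = p`, `E₂₁₃ = p ζᵏ`, `E₂₃₁ = ζᵐ`, `E₃₁₂ = ζ⁻ᵐ`,
`E₃₂₁ = p ζ⁻ᵏ`, where `ζ = exp (2πi/3)`, and zero at all triples that are not permutations;
the indices `1, 2, 3` are written `0, 1, 2`. -/
def arrayA (p : ℂ) (k m : ℕ) : Fin 3 → Fin 3 → Fin 3 → ℂ :=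
  let ζ : ℂ := Complex.exp (2 * Real.pi * Complex.I / 3)
  fun a b c => match a, b, c with
  | 0, 1, 2 => 1
  | 0, 2, 1 => p
  | 1, 0, 2 => p * ζ ^ k
  | 1, 2, 0 => ζ ^ m
  | 2, 0, 1 => ζ ^ (-(m : ℤ))
  | 2, 1, 0 => p * ζ ^ (-(k : ℤ))
  | _, _, _ => 0

/-! ## The compact group `𝕋² ⋊ A₃` -/

/-- The triple `(z, w, (zw)⁻¹)` attached to a point `(z, w)` of the two-dimensional torus. -/
def torusTriple (t : Circle × Circle) : Fin 3 → Circle := ![t.1, t.2, (t.1 * t.2)⁻¹]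

theorem torusTriple_mk (s : Fin 3 → Circle) (h : s 0 * s 1 * s 2 = 1) (i : Fin 3) :
    torusTriple (s 0, s 1) i = s i := by
  fin_cases i
  · rfl
  · rfl
  · exact inv_eq_of_mul_eq_one_right h

theorem torusTriple_prod (t : Circle × Circle) (a : Equiv.Perm (Fin 3)) :
    torusTriple t (a 0) * torusTriple t (a 1) * torusTriple t (a 2) = 1 := by
  have h := Equiv.prod_comp a (torusTriple t)
  rw [Fin.prod_univ_three, Fin.prod_univ_three] at h
  rw [h]
  simp [torusTriple]

theorem torusTriple_mul (s t : Circle × Circle) (i : Fin 3) :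
    torusTriple (s * t) i = torusTriple s i * torusTriple t i := by
  fin_cases i
  · rfl
  · rfl
  · change (s.1 * t.1 * (s.2 * t.2))⁻¹ = (s.1 * s.2)⁻¹ * (t.1 * t.2)⁻¹
    rw [← mul_inv, mul_mul_mul_comm]

/-- A permutation `a` acts on the torus by permuting the triple `(z, w, (zw)⁻¹)`: the `i`-th entry
of the new triple is the `a i`-th entry of the old one. -/
def torusPerm (a : Equiv.Perm (Fin 3)) (t : Circle × Circle) : Circle × Circle :=
  (torusTriple t (a 0), torusTriple t (a 1))

theorem torusTriple_torusPerm (a : Equiv.Perm (Fin 3)) (t : Circle × Circle) (i : Fin 3) :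
    torusTriple (torusPerm a t) i = torusTriple t (a i) :=
  torusTriple_mk (fun i => torusTriple t (a i)) (torusTriple_prod t a) i

theorem torusPerm_torusPerm (a b : Equiv.Perm (Fin 3)) (t : Circle × Circle) :
    torusPerm a (torusPerm b t) = torusPerm (b * a) t := by
  rw [torusPerm, torusTriple_torusPerm, torusTriple_torusPerm]
  rfl

theorem alternatingThree_mul_comm (a b : alternatingGroup (Fin 3)) :
    (a : Equiv.Perm (Fin 3)) * b = b * a := by
  revert a b
  decide

/-- The action `φ` of `A₃` on `𝕋²`: the identity acts trivially, the cycle `x = (231)` acts by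
`(z, w) ↦ (w, (zw)⁻¹)` and the cycle `y = (312)` acts by `(z, w) ↦ ((zw)⁻¹, z)`. -/
def torusAction : alternatingGroup (Fin 3) →* MulAut (Circle × Circle) where
  toFun a :=
    { toFun := torusPerm a
      invFun := torusPerm (a⁻¹ : Equiv.Perm (Fin 3))
      left_inv := fun t => by rw [torusPerm_torusPerm, mul_inv_cancel]; rfl
      right_inv := fun t => by rw [torusPerm_torusPerm, inv_mul_cancel]; rfl
      map_mul' := fun s t => by
        simp only [torusPerm, torusTriple_mul]
        rfl }
  map_one' := by
    ext t <;> rfl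
  map_mul' a b := by
    refine MulEquiv.ext fun t => ?_
    change torusPerm ((a : Equiv.Perm (Fin 3)) * b) t = torusPerm a (torusPerm b t)
    rw [torusPerm_torusPerm, alternatingThree_mul_comm]

/-- The semidirect product `𝕋² ⋊ A₃`. -/
abbrev TorusA3 : Type := (Circle × Circle) ⋊[torusAction] alternatingGroup (Fin 3)

/-- The product topology of `𝕋²` and the discrete space `A₃`. -/
instance : TopologicalSpace TorusA3 :=
  TopologicalSpace.induced (fun g => g.left) inferInstance ⊓
    TopologicalSpace.induced (fun g => g.right) ⊥

theorem torusA3_continuous_left : Continuous fun g : TorusA3 => g.left :=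
  continuous_iff_le_induced.2 inf_le_left

theorem torusA3_continuous_right {X : Type*} [TopologicalSpace X]
    (f : alternatingGroup (Fin 3) → X) : Continuous fun g : TorusA3 => f g.right := by
  let _ : TopologicalSpace (alternatingGroup (Fin 3)) := ⊥
  have h : Continuous fun g : TorusA3 => g.right := continuous_iff_le_induced.2 inf_le_right
  exact (continuous_bot (f := f)).comp h

theorem torusA3_continuous_mk (a : alternatingGroup (Fin 3)) :
    Continuous fun t : Circle × Circle => (⟨t, a⟩ : TorusA3) := by
  refine continuous_inf_rng.2 ⟨continuous_induced_rng.2 ?_, continuous_induced_rng.2 ?_⟩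
  · exact continuous_id (X := Circle × Circle)
  · exact @continuous_const _ _ _ ⊥ a

theorem torusPerm_continuous (a : Equiv.Perm (Fin 3)) : Continuous (torusPerm a) := by
  have h : ∀ i, Continuous fun t => torusTriple t i := by
    intro i
    fin_cases i
    · exact continuous_fst
    · exact continuous_snd
    · exact (continuous_fst.mul continuous_snd).inv
  exact (h _).prodMk (h _)

theorem torusA3_continuous_iff {X : Type*} [TopologicalSpace X] {f : TorusA3 → X} :
    Continuous f ↔ ∀ a, Continuous fun t : Circle × Circle => f ⟨t, a⟩ := by
  refine ⟨fun h a => h.comp (torusA3_continuous_mk a), fun h => ?_⟩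
  let _ : TopologicalSpace (alternatingGroup (Fin 3)) := ⊥
  have _ : DiscreteTopology (alternatingGroup (Fin 3)) := ⟨rfl⟩
  have h1 : Continuous fun g : TorusA3 => (g.right, g.left) :=
    (torusA3_continuous_right id).prodMk torusA3_continuous_left
  have h2 : Continuous fun q : alternatingGroup (Fin 3) × (Circle × Circle) =>
      f ⟨q.2, q.1⟩ := continuous_prod_of_discrete_left.2 h
  exact h2.comp h1

instance : CompactSpace TorusA3 := by
  refine ⟨?_⟩
  have h : (Set.univ : Set TorusA3) =
      ⋃ a : alternatingGroup (Fin 3), Set.range fun t => (⟨t, a⟩ : TorusA3) := by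
    ext g
    simp only [Set.mem_univ, Set.mem_iUnion, Set.mem_range, true_iff]
    exact ⟨g.right, g.left, rfl⟩
  rw [h]
  exact isCompact_iUnion fun a => isCompact_range (torusA3_continuous_mk a)

instance : T2Space TorusA3 := by
  let _ : TopologicalSpace (alternatingGroup (Fin 3)) := ⊥
  have _ : DiscreteTopology (alternatingGroup (Fin 3)) := ⟨rfl⟩
  refine T2Space.of_injective_continuous (f := fun g : TorusA3 => (g.left, g.right)) ?_
    (torusA3_continuous_left.prodMk (torusA3_continuous_right id))
  intro g h hgh
  exact SemidirectProduct.ext (congrArg Prod.fst hgh) (congrArg Prod.snd hgh)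

instance : IsTopologicalGroup TorusA3 where
  continuous_mul := by
    let _ : TopologicalSpace (alternatingGroup (Fin 3)) := ⊥
    have _ : DiscreteTopology (alternatingGroup (Fin 3)) := ⟨rfl⟩
    have h1 : Continuous fun q : TorusA3 × TorusA3 =>
        (q.1.right, (q.2.right, (q.1.left, q.2.left))) :=
      ((torusA3_continuous_right id).comp continuous_fst).prodMk
        (((torusA3_continuous_right id).comp continuous_snd).prodMk
          ((torusA3_continuous_left.comp continuous_fst).prodMk
            (torusA3_continuous_left.comp continuous_snd)))
    have h2 : Continuous fun q : alternatingGroup (Fin 3) × alternatingGroup (Fin 3) ×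
        (Circle × Circle) × (Circle × Circle) =>
        (⟨q.2.2.1 * torusPerm q.1 q.2.2.2, q.1 * q.2.1⟩ : TorusA3) :=
      continuous_prod_of_discrete_left.2 fun a => continuous_prod_of_discrete_left.2 fun b =>
        (torusA3_continuous_mk (a * b)).comp
          (continuous_fst.mul ((torusPerm_continuous a).comp continuous_snd))
    exact h2.comp h1
  continuous_inv := torusA3_continuous_iff.2 fun a =>
    (torusA3_continuous_mk a⁻¹).comp
      ((torusPerm_continuous ((a⁻¹ : alternatingGroup (Fin 3)) : Equiv.Perm (Fin 3))).comp
        continuous_inv)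

/-- The monomial unitary matrix of an element `(z, w; a)` of `𝕋² ⋊ A₃`: the only nonzero entries
are `z`, `w`, `(zw)⁻¹` in rows `1, 2, 3`, and the entry of row `i` stands in column `a i`. -/
def torusA3Matrix (g : TorusA3) : Matrix (Fin 3) (Fin 3) ℂ :=
  fun i j => if j = (g.right : Equiv.Perm (Fin 3)) i then (torusTriple g.left i : ℂ) else 0

end

/-! Multiplying the determinant relation by adjoints of the entries strips factors one at a time.
Stripping one factor makes `star (v a i)` a twisted 2×2 minor and makes entries of one row
skew-commute with factor `-p`; stripping all three shows that the relations pass to the transpose.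
Comparing the minor formulas for `v` and its transpose gives commutation relations between two rows,
as for quantum matrices.

These are overdetermined. When `p ≠ 0` and `p * p ≠ 1`, reordering a cubic product yields `v a k *
star (v (a + 2) k) = 0`, and the C*-identity upgrades this to orthogonality within every row and
column. Unitarity then makes the entries normal partial isometries, the anticyclic half of each
minor vanishes, and all entries commute.

Being commutative, the algebra is determined by its characters, that is, by scalar solutions. These
are exactly the monomial matrices of `TorusA3`, so Gelfand duality gives injectivity of the map to
`C(TorusA3, ℂ)`, and Stone–Weierstrass gives surjectivity. -/

theorem arrayA_zero_zero_eq (p : ℂ) (a b c : Fin 3) : arrayA p 0 0 a b c =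
    if b = a + 1 ∧ c = a + 2 then 1 else if b = a + 2 ∧ c = a + 1 then p else 0 := by
  fin_cases a <;> fin_cases b <;> fin_cases c <;> simp [arrayA]

theorem arrayA_cyclic (p : ℂ) (a b c : Fin 3) : arrayA p 0 0 b c a = arrayA p 0 0 a b c := by
  fin_cases a <;> fin_cases b <;> fin_cases c <;> simp [arrayA]

theorem star_arrayA (p : ℝ) (a b c : Fin 3) :
    star (arrayA p 0 0 a b c) = arrayA p 0 0 a b c := by
  rw [arrayA_zero_zero_eq]
  split_ifs <;> simp

theorem sum_arrayA_smul {M : Type*} [AddCommGroup M] [Module ℂ M] (p : ℂ) (i : Fin 3)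
    (F : Fin 3 → Fin 3 → M) : ∑ j, ∑ k, arrayA p 0 0 i j k • F j k =
      F (i + 1) (i + 2) + p • F (i + 2) (i + 1) := by
  fin_cases i <;> simp [arrayA, Fin.sum_univ_three, add_comm]

theorem sum_arrayA_smul_left {M : Type*} [AddCommGroup M] [Module ℂ M] (p : ℂ) (b c : Fin 3)
    (F : Fin 3 → M) : ∑ a, arrayA p 0 0 a b c • F a =
      if c = b + 1 then F (b + 2) else if c = b + 2 then p • F (b + 1) else 0 := by
  fin_cases b <;> fin_cases c <;> simp [arrayA, Fin.sum_univ_three]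

/-- An overlap of the quadratic relations in a twisted matrix bialgebra. -/
theorem mul_eq_zero_of_twisted_relations {B : Type*} [Ring B] [Algebra ℂ B] {q : ℂ}
    (hq : q * q ≠ 1) {x y z X Y Z : B}
    (hxy : x * y = -q • (y * x)) (hzx : z * x = -q • (x * z)) (hxZ : x * Z = Z * x)
    (hyZ : q • (y * Z - Z * y) = (1 - q * q) • (z * Y))
    (hxY : q • (x * Y - Y * x) = (1 - q * q) • (y * X)) :
    z * (x * Y + q • (y * X)) = 0 := by
  have hq' : 1 - q * q ≠ 0 := sub_ne_zero.2 hq.symm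
  -- The strategy is to write everything as a multiple of `z * (Y * x)`. Here `hyZ` trades `z * Y`
  -- for a commutator of `y` and `Z`, past which `x` can be moved.
  have h1 : x * (z * Y) = -q • (z * (Y * x)) := by
    refine smul_right_injective B hq' ?_
    change (1 - q * q) • _ = (1 - q * q) • _
    calc (1 - q * q) • (x * (z * Y)) = x * ((1 - q * q) • (z * Y)) := by rw [mul_smul_comm]
      _ = q • (x * y * Z - x * Z * y) := by rw [← hyZ, mul_smul_comm, mul_sub, mul_assoc, mul_assoc]
      _ = q • (-q • (y * (x * Z)) - Z * (x * y)) := by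
        rw [hxy, hxZ, smul_mul_assoc, mul_assoc, mul_assoc, hxZ, hxy]
      _ = -q • (q • (y * Z - Z * y) * x) := by
        rw [hxZ, hxy, mul_smul_comm, smul_mul_assoc, sub_mul, mul_assoc, mul_assoc]
        module
      _ = (1 - q * q) • -q • (z * (Y * x)) := by
        rw [hyZ, smul_mul_assoc, mul_assoc, smul_comm]
  have h2 : z * (x * Y) = (q * q) • (z * (Y * x)) := by
    rw [← mul_assoc, hzx, smul_mul_assoc, mul_assoc, h1]
    module
  have h3 : z * (y * X) = -q • (z * (Y * x)) := by
    refine smul_right_injective B hq' ?_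
    change (1 - q * q) • _ = (1 - q * q) • _
    rw [← mul_smul_comm, ← hxY, mul_smul_comm, mul_sub, h2]
    module
  -- The two coefficients, `q * q` and `q * -q`, cancel.
  rw [mul_add, mul_smul_comm, h2, h3]
  module

/-- By the C*-identity: `(x * y) * star (x * y)` equals `q • (y * x * star y * star x)`, which
contains `x * star y`. -/
theorem mul_eq_zero_of_twisted_commute {B : Type*} [CStarAlgebra B] {x y : B} {q : ℂ}
    (hxy : x * y = q • (y * x)) (h : x * star y = 0) : x * y = 0 := by
  rw [← CStarRing.mul_star_self_eq_zero_iff]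
  nth_rw 1 [hxy]
  rw [StarMul.star_mul, smul_mul_assoc, mul_assoc, ← mul_assoc x, h, zero_mul, mul_zero, smul_zero]

/-- The part of the Woronowicz relations for `arrayA p 0 0` that involves `star v * v`. -/
structure IsTwistedIsometry (p : ℝ) {B : Type*} [Ring B] [StarRing B] [Algebra ℂ B]
    (v : Matrix (Fin 3) (Fin 3) B) : Prop where
  star_mul : ∀ j k, ∑ s, star (v s j) * v s k = if j = k then 1 else 0
  twisted_det : ∀ a b c, ∑ i, ∑ j, ∑ k, arrayA p 0 0 i j k • (v a i * v b j * v c k) =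
    arrayA p 0 0 a b c • (1 : B)

namespace IsTwistedIsometry

/-! ### Algebraic consequences: contraction, transposition, commutation relations -/

section Ring

variable {p : ℝ} {B : Type*} [Ring B] [StarRing B] [Algebra ℂ B]
  {v : Matrix (Fin 3) (Fin 3) B}

/-- The adjoint is a left inverse of `v`; each use strips the leftmost factor from the determinant
relation. -/
theorem sum_star_mul_sum (hv : IsTwistedIsometry p v) (i : Fin 3) (F : Fin 3 → B) :
    ∑ a, star (v a i) * ∑ j, v a j * F j = F i := by
  simp_rw [Finset.mul_sum, ← mul_assoc]
  rw [Finset.sum_comm]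
  simp_rw [← Finset.sum_mul, hv.star_mul]
  simp

/-- For `b ≠ c` this expresses adjoints as twisted minors; for `b = c` the right side vanishes and
skew-commutation within a row remains. -/
theorem contract_first (hv : IsTwistedIsometry p v) (i b c : Fin 3) :
    ∑ j, ∑ k, arrayA p 0 0 i j k • (v b j * v c k) =
      ∑ a, arrayA p 0 0 a b c • star (v a i) := by
  refine (hv.sum_star_mul_sum i fun i => ∑ j, ∑ k, arrayA p 0 0 i j k • (v b j * v c k)).symm.trans
    (Finset.sum_congr rfl fun a _ => ?_)
  have h : ∑ i, v a i * ∑ j, ∑ k, arrayA p 0 0 i j k • (v b j * v c k) =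
      arrayA p 0 0 a b c • (1 : B) := by
    rw [← hv.twisted_det]
    simp only [Finset.mul_sum, mul_smul_comm, mul_assoc]
  rw [h, mul_smul_comm, mul_one]

theorem contract_second (hv : IsTwistedIsometry p v) (i j c : Fin 3) :
    ∑ k, arrayA p 0 0 i j k • v c k =
      ∑ b, ∑ a, arrayA p 0 0 a b c • (star (v b j) * star (v a i)) := by
  refine (hv.sum_star_mul_sum j fun j => ∑ k, arrayA p 0 0 i j k • v c k).symm.trans
    (Finset.sum_congr rfl fun b _ => ?_)
  have h : ∑ j, v b j * ∑ k, arrayA p 0 0 i j k • v c k =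
      ∑ a, arrayA p 0 0 a b c • star (v a i) := by
    rw [← hv.contract_first]
    simp only [Finset.mul_sum, mul_smul_comm]
  rw [h]
  simp only [Finset.mul_sum, mul_smul_comm]

theorem contract_third (hv : IsTwistedIsometry p v) (i j k : Fin 3) :
    ∑ c, ∑ b, ∑ a, arrayA p 0 0 a b c • (star (v c k) * (star (v b j) * star (v a i))) =
      arrayA p 0 0 i j k • (1 : B) := by
  refine Eq.symm ((hv.sum_star_mul_sum k fun k => arrayA p 0 0 i j k • (1 : B)).symm.trans
    (Finset.sum_congr rfl fun c _ => ?_))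
  have h : ∑ k, v c k * arrayA p 0 0 i j k • (1 : B) =
      ∑ b, ∑ a, arrayA p 0 0 a b c • (star (v b j) * star (v a i)) := by
    rw [← hv.contract_second]
    simp only [mul_smul_comm, mul_one]
  rw [h]
  simp only [Finset.mul_sum, mul_smul_comm]

theorem star_apply (hv : IsTwistedIsometry p v) (a i : Fin 3) : star (v a i) =
    v (a + 1) (i + 1) * v (a + 2) (i + 2) +
      (p : ℂ) • (v (a + 1) (i + 2) * v (a + 2) (i + 1)) := by
  have h := hv.contract_first i (a + 1) (a + 2)
  rw [sum_arrayA_smul, sum_arrayA_smul_left, if_pos (by grind)] at h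
  rw [h]
  congr 2
  grind

theorem smul_star_apply (hv : IsTwistedIsometry p v) (a i : Fin 3) : (p : ℂ) • star (v a i) =
    v (a + 2) (i + 1) * v (a + 1) (i + 2) +
      (p : ℂ) • (v (a + 2) (i + 2) * v (a + 1) (i + 1)) := by
  have h := hv.contract_first i (a + 2) (a + 1)
  rw [sum_arrayA_smul, sum_arrayA_smul_left, if_neg (by grind), if_pos (by grind)] at h
  rw [h]
  congr 3
  grind

theorem row_mul (hv : IsTwistedIsometry p v) (b i : Fin 3) :
    v b i * v b (i + 1) = -(p : ℂ) • (v b (i + 1) * v b i) := by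
  have h := hv.contract_first (i + 2) b b
  rw [sum_arrayA_smul, sum_arrayA_smul_left, if_neg (by grind), if_neg (by grind)] at h
  have h1 : i + 2 + 1 = i := by grind
  have h2 : i + 2 + 2 = i + 1 := by grind
  rw [h1, h2] at h
  rw [neg_smul]
  exact eq_neg_of_add_eq_zero_left h

/-- The determinant condition for the transpose is the adjoint of `contract_third`, as `E` is real.
For the isometry condition, substituting the minor formula for `star (v a i)` turns the sum into a
determinant relation, by cyclicity of `E`. Every row statement thereby has a column counterpart. -/
theorem transpose [StarModule ℂ B] (hv : IsTwistedIsometry p v) :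
    IsTwistedIsometry p v.transpose where
  star_mul a d := by
    simp only [Matrix.transpose_apply]
    have h1 : ∀ i, star (v a i) = ∑ j, ∑ k, arrayA p 0 0 i j k • (v (a + 1) j * v (a + 2) k) := by
      intro i
      rw [hv.star_apply, sum_arrayA_smul]
    have h2 : arrayA p 0 0 (a + 1) (a + 2) d • (1 : B) = if a = d then 1 else 0 := by
      fin_cases a <;> fin_cases d <;> simp [arrayA]
    rw [← h2, ← hv.twisted_det]
    simp_rw [h1, Finset.sum_mul, smul_mul_assoc]
    rw [Finset.sum_comm]
    refine Finset.sum_congr rfl fun j _ => ?_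
    rw [Finset.sum_comm]
    simp_rw [arrayA_cyclic]
  twisted_det i j k := by
    have h := congrArg star (hv.contract_third i j k)
    simp only [star_sum, star_smul, StarMul.star_mul, star_star, star_one, star_arrayA] at h
    simp only [Matrix.transpose_apply]
    rw [← h, Finset.sum_comm]
    conv_rhs => rw [Finset.sum_comm]
    refine Finset.sum_congr rfl fun b _ => ?_
    rw [Finset.sum_comm]

/-- The minor formulas for `v` and its transpose share the cyclic term, so their anticyclic terms
agree. -/
theorem commute_odd [StarModule ℂ B] (hv : IsTwistedIsometry p v) (hp : p ≠ 0) (a i : Fin 3) :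
    v a (i + 1) * v (a + 1) i = v (a + 1) i * v a (i + 1) := by
  have h := (hv.star_apply (a + 2) (i + 2)).symm.trans (hv.transpose.star_apply (i + 2) (a + 2))
  have e1 (j : Fin 3) : j + 2 + 1 = j := by grind
  have e2 (j : Fin 3) : j + 2 + 2 = j + 1 := by grind
  simp only [e1, e2, Matrix.transpose_apply, add_right_inj] at h
  exact smul_right_injective B (Complex.ofReal_ne_zero.2 hp) h

theorem smul_commutator_even [StarModule ℂ B] (hv : IsTwistedIsometry p v) (hp : p ≠ 0)
    (a i : Fin 3) :
    (p : ℂ) • (v a i * v (a + 1) (i + 1) - v (a + 1) (i + 1) * v a i) =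
      (1 - (p : ℂ) * p) • (v a (i + 1) * v (a + 1) i) := by
  have h1 := hv.star_apply (a + 2) (i + 2)
  have h2 := hv.smul_star_apply (a + 2) (i + 2)
  have e1 (j : Fin 3) : j + 2 + 1 = j := by grind
  have e2 (j : Fin 3) : j + 2 + 2 = j + 1 := by grind
  simp only [e1, e2] at h1 h2
  rw [h1, ← hv.commute_odd hp] at h2
  linear_combination (norm := module) h2

/-- The adjoint is a minor of rows `a` and `a + 1`, and the factor `v a k` lies in the column which
that minor omits: the overlap lemma applies. -/
theorem mul_star_eq_zero [StarModule ℂ B] (hv : IsTwistedIsometry p v) (hp : p ≠ 0)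
    (hp' : p * p ≠ 1) (a k : Fin 3) : v a k * star (v (a + 2) k) = 0 := by
  have e1 (j : Fin 3) : j + 2 + 1 = j := by grind
  have e2 (j : Fin 3) : j + 2 + 2 = j + 1 := by grind
  have e3 (j : Fin 3) : j + 1 + 1 = j + 2 := by grind
  have h1 := hv.row_mul a (k + 1)
  have h2 := hv.row_mul a k
  have h3 := hv.commute_odd hp a k
  have h4 := hv.smul_commutator_even hp a (k + 2)
  have h5 := hv.smul_commutator_even hp a (k + 1)
  have h6 := hv.star_apply (a + 2) k
  simp only [e1, e2, e3] at h1 h4 h5 h6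
  rw [h6]
  exact mul_eq_zero_of_twisted_relations (by exact_mod_cast hp') h1 h2 h3 h4 h5

end Ring

/-! ### Orthogonality within rows and columns -/

section CStarAlgebra

variable {p : ℝ} {B : Type*} [CStarAlgebra B] {v : Matrix (Fin 3) (Fin 3) B}

theorem col_mul_eq_zero (hv : IsTwistedIsometry p v) (hp : p ≠ 0) (hp' : p * p ≠ 1)
    {a b : Fin 3} (hab : a ≠ b) (k : Fin 3) : v a k * v b k = 0 ∧ v a k * star (v b k) = 0 := by
  have e1 (j : Fin 3) : j + 2 + 1 = j := by grind
  have key (a : Fin 3) : (v (a + 2) k * v a k = 0 ∧ v (a + 2) k * star (v a k) = 0) ∧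
      v a k * v (a + 2) k = 0 ∧ v a k * star (v (a + 2) k) = 0 := by
    have h1 := hv.mul_star_eq_zero hp hp' a k
    have h2 : v (a + 2) k * star (v a k) = 0 := by
      simpa using congrArg star h1
    have h3 := hv.transpose.row_mul k (a + 2)
    simp only [e1, Matrix.transpose_apply] at h3
    have h4 := mul_eq_zero_of_twisted_commute h3 h2
    have h5 : v a k * v (a + 2) k = 0 := by
      rw [h4, eq_comm, smul_eq_zero] at h3
      exact h3.resolve_left (by simpa using hp)
    exact ⟨⟨h4, h2⟩, h5, h1⟩
  obtain rfl | rfl : b = a + 2 ∨ a = b + 2 := by grind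
  · exact (key a).2
  · exact (key b).1

theorem row_mul_eq_zero (hv : IsTwistedIsometry p v) (hp : p ≠ 0) (hp' : p * p ≠ 1)
    {i j : Fin 3} (hij : i ≠ j) (a : Fin 3) : v a i * v a j = 0 ∧ v a i * star (v a j) = 0 :=
  hv.transpose.col_mul_eq_zero hp hp' hij a

end CStarAlgebra

end IsTwistedIsometry

/-! ### Normal partial isometries and commutativity -/

namespace IsWoronowiczMatrix

variable {p : ℝ} {B : Type*} [CStarAlgebra B] {v : Matrix (Fin 3) (Fin 3) B}

theorem isTwistedIsometry (hv : IsWoronowiczMatrix (arrayA p 0 0) v) : IsTwistedIsometry p v :=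
  ⟨hv.star_mul, hv.twisted_det⟩

theorem mul_mul_star_self (hv : IsWoronowiczMatrix (arrayA p 0 0) v) (hp : p ≠ 0)
    (hp' : p * p ≠ 1) (a i : Fin 3) : v a i * (v a i * star (v a i)) = v a i := by
  have h := congrArg (v a i * ·) (hv.mul_star a a)
  simp only [Finset.mul_sum, if_pos, mul_one] at h
  rw [Finset.sum_eq_single i _ (by simp)] at h
  · exact h
  · intro j _ hj
    rw [← mul_assoc, (hv.isTwistedIsometry.row_mul_eq_zero hp hp' hj.symm a).1, zero_mul]

theorem mul_star_mul_self (hv : IsWoronowiczMatrix (arrayA p 0 0) v) (hp : p ≠ 0)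
    (hp' : p * p ≠ 1) (a i : Fin 3) : v a i * (star (v a i) * v a i) = v a i := by
  have h := congrArg (v a i * ·) (hv.isTwistedIsometry.transpose.star_mul a a)
  simp only [Finset.mul_sum, if_pos, mul_one, Matrix.transpose_apply] at h
  rw [Finset.sum_eq_single i _ (by simp)] at h
  · exact h
  · intro j _ hj
    rw [← mul_assoc, (hv.isTwistedIsometry.row_mul_eq_zero hp hp' hj.symm a).2, zero_mul]

/-- Inserting the row sum of `star (v a j) * v a j` leaves only `j = i`, and the adjoint of
`mul_mul_star_self` absorbs the extra factor. -/
theorem mul_star_eq_star_mul (hv : IsWoronowiczMatrix (arrayA p 0 0) v) (hp : p ≠ 0)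
    (hp' : p * p ≠ 1) (a i : Fin 3) : v a i * star (v a i) = star (v a i) * v a i := by
  have h := congrArg (v a i * star (v a i) * ·) (hv.isTwistedIsometry.transpose.star_mul a a)
  simp only [Finset.mul_sum, if_pos, mul_one, Matrix.transpose_apply] at h
  rw [Finset.sum_eq_single i _ (by simp)] at h
  · have h1 := congrArg star (hv.mul_mul_star_self hp hp' a i)
    simp only [StarMul.star_mul, star_star] at h1
    rw [← h, ← mul_assoc, h1]
  · intro j _ hj
    rw [mul_assoc, ← mul_assoc (star (v a i)) (star (v a j)), ← StarMul.star_mul,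
      (hv.isTwistedIsometry.row_mul_eq_zero hp hp' hj a).1, star_zero, zero_mul, mul_zero]

theorem odd_mul_eq_zero (hv : IsWoronowiczMatrix (arrayA p 0 0) v) (hp : p ≠ 0)
    (hp' : p * p ≠ 1) (a i : Fin 3) : v a (i + 1) * v (a + 1) i = 0 := by
  have h := hv.isTwistedIsometry
  have e1 (j : Fin 3) : j + 2 + 1 = j := by grind
  have e2 (j : Fin 3) : j + 2 + 2 = j + 1 := by grind
  have h1 := h.star_apply (a + 2) (i + 2)
  have h2 := h.smul_star_apply (a + 2) (i + 2)
  simp only [e1, e2] at h1 h2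
  have h3 : v a (i + 1) * v a i = 0 := (h.row_mul_eq_zero hp hp' (by simp) a).1
  have h4 : v a (i + 1) * v (a + 1) (i + 1) = 0 := (h.col_mul_eq_zero hp hp' (by simp) _).1
  -- Left multiplication by `v a (i + 1)` kills the cyclic terms of both minor formulas, leaving one
  -- product with coefficients `p * p` and `1`.
  have h5 : v a (i + 1) * (v a (i + 1) * v (a + 1) i) = 0 := by
    have h6 := congrArg (v a (i + 1) * ·) h2
    simp only [h1, ← h.commute_odd hp, mul_add, mul_smul_comm, ← mul_assoc, h3, h4, zero_mul,
      smul_zero, add_zero, zero_add] at h6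
    rw [smul_smul, mul_assoc] at h6
    have h7 : ((p : ℂ) * p - 1) • (v a (i + 1) * (v a (i + 1) * v (a + 1) i)) = 0 := by
      rw [sub_smul, one_smul, sub_eq_zero, h6]
    exact (smul_eq_zero.1 h7).resolve_left (sub_ne_zero.2 (by exact_mod_cast hp'))
  -- By normality `v a (i + 1)` equals `star (v a (i + 1)) * v a (i + 1) * v a (i + 1)`, so the
  -- square in `h5` can be reduced to a first power.
  rw [← hv.mul_star_mul_self hp hp', ← mul_assoc (v a (i + 1)), hv.mul_star_eq_star_mul hp hp',
    mul_assoc, mul_assoc, h5, mul_zero]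

theorem star_apply (hv : IsWoronowiczMatrix (arrayA p 0 0) v) (hp : p ≠ 0)
    (hp' : p * p ≠ 1) (a i : Fin 3) :
    star (v a i) = v (a + 1) (i + 1) * v (a + 2) (i + 2) := by
  have e1 (j : Fin 3) : j + 1 + 1 = j + 2 := by grind
  have h := hv.odd_mul_eq_zero hp hp' (a + 1) (i + 1)
  rw [e1, e1] at h
  rw [hv.isTwistedIsometry.star_apply, h, smul_zero, add_zero]

theorem mul_comm (hv : IsWoronowiczMatrix (arrayA p 0 0) v) (hp : p ≠ 0)
    (hp' : p * p ≠ 1) (a b i j : Fin 3) : v a i * v b j = v b j * v a i := by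
  have h := hv.isTwistedIsometry
  have key (a i j : Fin 3) : v a i * v (a + 1) j = v (a + 1) j * v a i := by
    obtain rfl | rfl | rfl : i = j ∨ j = i + 1 ∨ i = j + 1 := by grind
    · rw [(h.col_mul_eq_zero hp hp' (by simp) i).1, (h.col_mul_eq_zero hp hp' (by simp) i).1]
    · have h1 := h.smul_commutator_even hp a i
      rw [hv.odd_mul_eq_zero hp hp', smul_zero, smul_eq_zero, sub_eq_zero] at h1
      exact h1.resolve_left (by exact_mod_cast hp)
    · exact h.commute_odd hp a j
  obtain rfl | rfl | rfl : a = b ∨ b = a + 1 ∨ a = b + 1 := by grind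
  · obtain rfl | hij := eq_or_ne i j
    · rfl
    · rw [(h.row_mul_eq_zero hp hp' hij a).1, (h.row_mul_eq_zero hp hp' hij.symm a).1]
  · exact key a i j
  · exact (key b j i).symm

end IsWoronowiczMatrix

/-! ### Gelfand duality, Stone–Weierstrass and commutativity of the universal algebra -/

theorem CStarAlgebra.eq_of_forall_starAlgHom_eq {A : Type*} [CStarAlgebra A]
    (hA : ∀ a b : A, a * b = b * a) {a b : A} (h : ∀ χ : A →⋆ₐ[ℂ] ℂ, χ a = χ b) : a = b := by
  let _ : CommCStarAlgebra A := { (inferInstance : CStarAlgebra A) with mul_comm := hA }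
  refine (gelfandTransform_isometry A).injective (ContinuousMap.ext fun χ => ?_)
  exact h { WeakDual.CharacterSpace.toAlgHom χ with map_star' := fun x => map_star χ x }

/-- An injective `*`-homomorphism is isometric, so its range is closed, and Stone–Weierstrass
applies. -/
theorem StarAlgHom.surjective_of_separatesPoints {A X : Type*} [CStarAlgebra A]
    [TopologicalSpace X] [CompactSpace X] (f : A →⋆ₐ[ℂ] C(X, ℂ)) (hf : Function.Injective f)
    (h : ∀ x y, (∀ a, f a x = f a y) → x = y) : Function.Surjective f := by
  have h1 : f.range.topologicalClosure = f.range := le_antisymm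
    (StarSubalgebra.topologicalClosure_minimal le_rfl
      (NonUnitalStarAlgHom.isometry f hf).isClosedEmbedding.isClosed_range)
    (StarSubalgebra.le_topologicalClosure _)
  have h2 : f.range = ⊤ := by
    rw [← h1]
    refine ContinuousMap.starSubalgebra_topologicalClosure_eq_top_of_separatesPoints _ ?_
    intro x y
    contrapose!
    exact fun hxy => h x y fun a => hxy (f a) ⟨f a, ⟨a, rfl⟩, rfl⟩
  intro y
  have hy : y ∈ f.range := h2 ▸ StarSubalgebra.mem_top
  exact hy

theorem IsWoronowiczMatrix.map {E : Fin 3 → Fin 3 → Fin 3 → ℂ} {A B : Type*} [Ring A] [StarRing A]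
    [Algebra ℂ A] [Ring B] [StarRing B] [Algebra ℂ B] {v : Matrix (Fin 3) (Fin 3) A}
    (hv : IsWoronowiczMatrix E v) (f : A →⋆ₐ[ℂ] B) :
    IsWoronowiczMatrix E fun i j => f (v i j) where
  mul_star j k := by
    simp only [← map_star, ← map_mul, ← map_sum, hv.mul_star]
    split_ifs <;> simp
  star_mul j k := by
    simp only [← map_star, ← map_mul, ← map_sum, hv.star_mul]
    split_ifs <;> simp
  twisted_det a b c := by
    simp only [← map_mul, ← map_smul, ← map_sum, hv.twisted_det]
    rw [map_smul, map_one]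

theorem IsWoronowiczMatrix.of_eval {E : Fin 3 → Fin 3 → Fin 3 → ℂ} {X : Type*}
    [TopologicalSpace X] {v : Matrix (Fin 3) (Fin 3) C(X, ℂ)}
    (hv : ∀ x, IsWoronowiczMatrix E fun i j => v i j x) : IsWoronowiczMatrix E v where
  mul_star j k := by
    ext x
    have h := (hv x).mul_star j k
    split_ifs at h ⊢ <;> simpa using h
  star_mul j k := by
    ext x
    have h := (hv x).star_mul j k
    split_ifs at h ⊢ <;> simpa using h
  twisted_det a b c := by
    ext x
    simpa using (hv x).twisted_det a b c

/-- Adjoints of generators are products of generators, so commuting generators also commute with all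
adjoints; commutativity survives closure. -/
theorem woronowiczAlgebra_mul_comm {p : ℝ} (hp : p ≠ 0) (hp' : p * p ≠ 1)
    (a b : WoronowiczAlgebra.{u} (arrayA p 0 0)) : a * b = b * a := by
  have hu := fundamentalMatrix_isWoronowiczMatrix.{u} (arrayA p 0 0)
  have h1 (i j k l : Fin 3) : WoronowiczProd.gen.{u} (arrayA p 0 0) i j * WoronowiczProd.gen _ k l =
      WoronowiczProd.gen _ k l * WoronowiczProd.gen _ i j :=
    congrArg Subtype.val (hu.mul_comm hp hp' i k j l)
  have h2 (i j : Fin 3) : star (WoronowiczProd.gen.{u} (arrayA p 0 0) i j) =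
      WoronowiczProd.gen _ (i + 1) (j + 1) * WoronowiczProd.gen _ (i + 2) (j + 2) :=
    congrArg Subtype.val (hu.star_apply hp hp' i j)
  have h3 : IsMulCommutative (StarAlgebra.adjoin ℂ (Set.range fun ij : Fin 3 × Fin 3 =>
      WoronowiczProd.gen.{u} (arrayA p 0 0) ij.1 ij.2)) := by
    refine StarAlgebra.isMulCommutative_adjoin ℂ ?_ ?_
    · rintro _ ⟨x, rfl⟩ _ ⟨y, rfl⟩
      exact h1 _ _ _ _
    · rintro _ ⟨x, rfl⟩ _ ⟨y, rfl⟩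
      simp only [h2]
      exact (Commute.mul_right (h1 _ _ _ _) (h1 _ _ _ _)).eq
  exact (StarSubalgebra.commRingTopologicalClosure _ fun x y => h3.is_comm.comm x y).mul_comm a b

/-! ### Monomial matrices as the scalar solutions -/

theorem alternatingThree_apply (a : alternatingGroup (Fin 3)) (i : Fin 3) :
    (a : Equiv.Perm (Fin 3)) i = i + (a : Equiv.Perm (Fin 3)) 0 := by
  revert a i
  decide

theorem addRight_mem_alternatingThree (s : Fin 3) :
    Equiv.addRight s ∈ alternatingGroup (Fin 3) := by
  rw [Equiv.Perm.mem_alternatingGroup]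
  revert s
  decide

theorem arrayA_add (p : ℂ) (a b c s : Fin 3) :
    arrayA p 0 0 (a + s) (b + s) (c + s) = arrayA p 0 0 a b c := by
  rw [arrayA_zero_zero_eq, arrayA_zero_zero_eq]
  congr 1
  · grind
  · congr 1
    grind

theorem torusTriple_cyclic (t : Circle × Circle) (i : Fin 3) :
    torusTriple t i * torusTriple t (i + 1) * torusTriple t (i + 2) = 1 :=
  torusTriple_prod t (Equiv.addLeft i) ▸ by simp

theorem torusA3Matrix_apply (g : TorusA3) (i j : Fin 3) : torusA3Matrix g i j =
    if j = i + (g.right : Equiv.Perm (Fin 3)) 0 then (torusTriple g.left i : ℂ) else 0 := by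
  rw [torusA3Matrix, alternatingThree_apply]

theorem isWoronowiczMatrix_torusA3Matrix (p : ℂ) (g : TorusA3) :
    IsWoronowiczMatrix (arrayA p 0 0) (torusA3Matrix g) where
  mul_star j k := by
    simp only [torusA3Matrix_apply, ite_mul, zero_mul, Finset.sum_ite_eq', Finset.mem_univ,
      if_true, add_left_inj]
    split_ifs with h
    · subst h
      simp [Complex.mul_conj]
    · simp
  star_mul j k := by
    rw [Finset.sum_eq_single (j - (g.right : Equiv.Perm (Fin 3)) 0)]
    · simp only [torusA3Matrix_apply, sub_add_cancel, if_true, @eq_comm _ k]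
      split_ifs with h
      · simp [← Complex.normSq_eq_conj_mul_self]
      · simp
    · intro s _ hs
      rw [torusA3Matrix_apply, if_neg (by rintro rfl; simp at hs)]
      simp
    · simp
  twisted_det a b c := by
    simp only [torusA3Matrix_apply, mul_ite, ite_mul, zero_mul, mul_zero, smul_ite, smul_zero,
      Finset.sum_ite_eq', Finset.mem_univ, if_true,
      arrayA_add]
    have h (i : Fin 3) : (torusTriple g.left i * torusTriple g.left (i + 1) *
        torusTriple g.left (i + 2) : ℂ) = 1 :=
      congrArg ((↑) : Circle → ℂ) (torusTriple_cyclic g.left i)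
    rw [arrayA_zero_zero_eq]
    split_ifs with h1 h1
    · rw [h1.1, h1.2, h]
    · rw [h1.1, h1.2, mul_right_comm, h]
    · simp

/-- One nonzero entry in row `0` forces, through `star_apply`, nonzero entries along its whole
cyclic diagonal; row orthogonality kills the rest. -/
theorem exists_torusA3Matrix_eq {p : ℝ} (hp : p ≠ 0) (hp' : p * p ≠ 1)
    {w : Matrix (Fin 3) (Fin 3) ℂ} (hw : IsWoronowiczMatrix (arrayA p 0 0) w) :
    ∃ g : TorusA3, torusA3Matrix g = w := by
  obtain ⟨s, hs⟩ : ∃ s, w 0 s ≠ 0 := by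
    by_contra! h
    simpa [h] using hw.mul_star 0 0
  have h0 := hw.star_apply hp hp' 0 s
  have h1 : w (0 + 1) (s + 1) * w (0 + 2) (s + 2) ≠ 0 := h0 ▸ star_ne_zero.2 hs
  have hne (i : Fin 3) : w i (i + s) ≠ 0 := by
    fin_cases i
    · simpa using hs
    · simpa [add_comm] using left_ne_zero_of_mul h1
    · simpa [add_comm] using right_ne_zero_of_mul h1
  have hnorm (i : Fin 3) : ‖w i (i + s)‖ = 1 := by
    have h2 := hw.mul_mul_star_self hp hp' i (i + s)
    rw [mul_eq_left₀ (hne i)] at h2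
    have h3 := congrArg norm h2
    rw [CStarRing.norm_self_mul_star, norm_one] at h3
    nlinarith [norm_nonneg (w i (i + s))]
  let t (i : Fin 3) : Circle := ⟨w i (i + s), mem_sphere_zero_iff_norm.2 (hnorm i)⟩
  have ht : t 0 * t 1 * t 2 = 1 := by
    refine Circle.ext ?_
    change w 0 (0 + s) * w 1 (1 + s) * w 2 (2 + s) = 1
    rw [zero_add, add_comm 1, add_comm 2, mul_assoc]
    change w 0 s * (w (0 + 1) (s + 1) * w (0 + 2) (s + 2)) = 1
    -- The last two factors form the conjugate of the first, so the product is its squared modulus.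
    rw [← h0, ← mul_eq_left₀ hs]
    exact hw.mul_mul_star_self hp hp' 0 s
  refine ⟨⟨(t 0, t 1), ⟨Equiv.addRight s, addRight_mem_alternatingThree s⟩⟩, ?_⟩
  ext i j
  rw [torusA3Matrix_apply]
  simp only [torusTriple_mk t ht, Equiv.coe_addRight, zero_add]
  split_ifs with h
  · rw [h]
  · have h2 := (hw.isTwistedIsometry.row_mul_eq_zero hp hp' h i).1
    exact ((mul_eq_zero.1 h2).resolve_right (hne i)).symm

/-- Multiplying monomial matrices composes column maps in reverse order, which is harmless because
`A₃` is abelian. -/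
theorem torusA3Matrix_mul (g h : TorusA3) :
    torusA3Matrix (g * h) = torusA3Matrix g * torusA3Matrix h := by
  ext i j
  have h1 : torusTriple (torusPerm (g.right : Equiv.Perm (Fin 3)) h.left) i =
      torusTriple h.left ((g.right : Equiv.Perm (Fin 3)) i) := torusTriple_torusPerm _ _ _
  have h2 : ((g * h).right : Equiv.Perm (Fin 3)) i =
      (h.right : Equiv.Perm (Fin 3)) ((g.right : Equiv.Perm (Fin 3)) i) := by
    rw [SemidirectProduct.mul_right, Subgroup.coe_mul, alternatingThree_mul_comm]
    rfl
  have h3 : torusTriple (g * h).left i = torusTriple g.left i *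
      torusTriple h.left ((g.right : Equiv.Perm (Fin 3)) i) := by
    rw [← h1, ← torusTriple_mul]
    rfl
  rw [Matrix.mul_apply, Finset.sum_eq_single ((g.right : Equiv.Perm (Fin 3)) i)]
  · simp only [torusA3Matrix, h2, h3, if_true, mul_ite, mul_zero, Circle.coe_mul]
  · intro k _ hk
    rw [torusA3Matrix, if_neg hk, zero_mul]
  · simp

theorem torusA3Matrix_injective : Function.Injective torusA3Matrix := by
  intro g h hgh
  have h1 (i : Fin 3) : (g.right : Equiv.Perm (Fin 3)) i = (h.right : Equiv.Perm (Fin 3)) i := by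
    have h2 := congrFun (congrFun hgh i) ((g.right : Equiv.Perm (Fin 3)) i)
    by_contra h3
    simp [torusA3Matrix, h3] at h2
  have h4 (i : Fin 3) : torusTriple g.left i = torusTriple h.left i := by
    have h2 := congrFun (congrFun hgh i) ((g.right : Equiv.Perm (Fin 3)) i)
    simp only [torusA3Matrix, if_true, if_pos (h1 i)] at h2
    exact Circle.ext h2
  exact SemidirectProduct.ext (Prod.ext (h4 0) (h4 1)) (Subtype.ext (Equiv.ext h1))

theorem continuous_torusA3Matrix_apply (i j : Fin 3) :
    Continuous fun g : TorusA3 => torusA3Matrix g i j := by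
  have h : Continuous fun t => torusTriple t i := by
    fin_cases i
    · exact continuous_fst
    · exact continuous_snd
    · exact (continuous_fst.mul continuous_snd).inv
  refine torusA3_continuous_iff.2 fun a => ?_
  simp only [torusA3Matrix]
  split_ifs
  · exact continuous_subtype_val.comp h
  · exact continuous_const

/-! ### The isomorphism and the comultiplication -/

theorem exists_woronowiczAlgebra_starAlgHom (p : ℂ) :
    ∃ Φ : WoronowiczAlgebra.{u} (arrayA p 0 0) →⋆ₐ[ℂ] C(TorusA3, ℂ),
      ∀ i j g, Φ (fundamentalMatrix (arrayA p 0 0) i j) g = torusA3Matrix g i j := by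
  -- The universal property concerns targets in `Type u`, hence the lift of the group.
  let w : Matrix (Fin 3) (Fin 3) C(ULift.{u} TorusA3, ℂ) := fun i j =>
    ⟨fun g => torusA3Matrix g.down i j,
      (continuous_torusA3Matrix_apply i j).comp continuous_uliftDown⟩
  have hw : IsWoronowiczMatrix (arrayA p 0 0) w :=
    .of_eval fun g => isWoronowiczMatrix_torusA3Matrix p g.down
  obtain ⟨f, hf, -⟩ := woronowicz_universal hw
  refine ⟨(ContinuousMap.compStarAlgHom' ℂ ℂ ⟨ULift.up, continuous_uliftUp⟩).comp f, fun i j g => ?_⟩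
  change f _ (ULift.up g) = _
  rw [hf]
  rfl

theorem mainTheorem10 (p : ℝ) (hp0 : p ≠ 0) (hp1 : p ≠ 1) (hp2 : p ≠ -1) :
    (∀ a b : WoronowiczAlgebra.{u} (arrayA p 0 0), a * b = b * a) ∧
    ∃ Φ : WoronowiczAlgebra.{u} (arrayA p 0 0) ≃⋆ₐ[ℂ] C(TorusA3, ℂ),
      (∀ i j g, Φ (fundamentalMatrix (arrayA p 0 0) i j) g = torusA3Matrix g i j) ∧
      ∃ Δ : WoronowiczAlgebra.{u} (arrayA p 0 0) →⋆ₐ[ℂ] C(TorusA3 × TorusA3, ℂ),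
        (∀ i j g h, Δ (fundamentalMatrix (arrayA p 0 0) i j) (g, h) =
          ∑ k, Φ (fundamentalMatrix (arrayA p 0 0) i k) g *
            Φ (fundamentalMatrix (arrayA p 0 0) k j) h) ∧
        ∀ a g h, Δ a (g, h) = Φ a (g * h) := by
  have hp' : p * p ≠ 1 := fun h => (mul_self_eq_one_iff.1 h).elim hp1 hp2
  have hcomm := woronowiczAlgebra_mul_comm.{u} hp0 hp'
  refine ⟨hcomm, ?_⟩
  obtain ⟨f, hf⟩ := exists_woronowiczAlgebra_starAlgHom.{u} (p : ℂ)
  have hinj : Function.Injective f := by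
    intro a b hab
    refine CStarAlgebra.eq_of_forall_starAlgHom_eq hcomm fun χ => ?_
    obtain ⟨g, hg⟩ := exists_torusA3Matrix_eq hp0 hp'
      ((fundamentalMatrix_isWoronowiczMatrix (arrayA p 0 0)).map χ)
    -- Every character is evaluation at a group element, so `f` separates whatever characters
    -- separate.
    have h : χ = (ContinuousMap.evalStarAlgHom ℂ ℂ g).comp f := woronowicz_hom_ext fun i j => by
      change _ = f _ g
      rw [hf, hg]
    rw [h, StarAlgHom.comp_apply, StarAlgHom.comp_apply, hab]
  have hsurj : Function.Surjective f := f.surjective_of_separatesPoints hinj fun g h hgh =>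
    torusA3Matrix_injective <| Matrix.ext fun i j => by rw [← hf, ← hf, hgh]
  refine ⟨StarAlgEquiv.ofBijective f ⟨hinj, hsurj⟩, hf,
    (ContinuousMap.compStarAlgHom' ℂ ℂ ⟨fun q : TorusA3 × TorusA3 => q.1 * q.2,
      continuous_mul⟩).comp f, fun i j g h => ?_, fun _ _ _ => rfl⟩
  change f _ (g * h) = ∑ k, f _ g * f _ h
  simp only [hf, torusA3Matrix_mul, Matrix.mul_apply]
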